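/- Let $(a(n))_{n\ge 0}$ be the Stern sequence, defined by $a(0)=0$, $a(1)=1$ and, for $n\ge 0$, $a(2n)=a(n)$ and $a(2n+1)=a(n)+a(n+1)$. A record-setter of the Stern sequence is an index $v\ge 0$ such that $a(i)<a(v)$ for all integers $0\le i<v$. For $n\ge 1$ let $(n)_2\in\{0,1\}^*$ be the base-$2$ representation of $n$, most significant digit first and without leading zeros, and let $(0)_2$ be the empty word. Then the language $$\{(v)_2 : v \text{ is a record-setter of the Stern sequence}\}\subseteq\{0,1\}^*$$ is context-free, i.e., it is generated by a context-free grammar. -/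

import Mathlib

/-- Stern's diatomic sequence: `a(0) = 0`, `a(1) = 1`, `a(2n) = a(n)`,
`a(2n+1) = a(n) + a(n+1)`. -/
def stern : ℕ → ℕ
  | 0 => 0
  | 1 => 1
  | n + 2 =>
    if n % 2 = 0 then stern (n / 2 + 1)
    else stern (n / 2 + 1) + stern (n / 2 + 2)
  termination_by n => n
  decreasing_by all_goals omega

theorem stern_zero : stern 0 = 0 := by
  rw [stern]

theorem stern_one : stern 1 = 1 := by
  rw [stern]

theorem stern_two_mul (n : ℕ) : stern (2 * n) = stern n := by
  rcases n with _ | m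
  · rfl
  · have h : 2 * (m + 1) = 2 * m + 2 := by ring
    rw [h, stern, if_pos (by omega)]
    congr 1
    omega

theorem stern_two_mul_add_one (n : ℕ) :
    stern (2 * n + 1) = stern n + stern (n + 1) := by
  rcases n with _ | m
  · simp [stern_zero, stern_one]
  · have h : 2 * (m + 1) + 1 = (2 * m + 1) + 2 := by ring
    have h1 : (2 * m + 1) / 2 = m := by omega
    rw [h, stern, if_neg (by omega), h1]

/-- An index `v` is a record-setter of the sequence `s` if `s i < s v` for all `i < v`. -/
def IsRecordSetter (s : ℕ → ℕ) (v : ℕ) : Prop :=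
  ∀ i < v, s i < s v

/-- The binary representation of `n`, most significant bit first and without leading zeros,
as a word over the alphabet `{0, 1}` (`false` is the digit `0`, `true` is the digit `1`).
The number `0` is represented by the empty word. -/
def binaryRep (n : ℕ) : List Bool :=
  (Nat.bits n).reverse

/-- The language of the binary representations of all record-setters of the Stern sequence. -/
def sternRecordLanguage : Language Bool :=
  {w : List Bool | ∃ v : ℕ, IsRecordSetter stern v ∧ binaryRep v = w}

/-! Appending a digit to `n` changes the pair (a(n), a(n+1)) from (x, y) to (x, x+y) for 0 and to
(x+y, y) for 1, so a(v) is computed by reading the digits of v after the leading 1 from the pair (1,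
1). Among all words of one length the maximum is a Fibonacci number, attained by the alternating
word (`run_le_peak`, `run_altWord`).

Comparison with smaller indices leaves little freedom to a record-setter. It must consist of blocks
`0…01`, possibly followed by one more 1 (`IsRecordSetter.exists_blockWord`). Call a block of d+1
zeros a defect of size d. Defects cost a definite proportion of the peak, and an early defect
already makes the index small. So a long record-setter has no defect, or one, or two of which the
first is the first block, or one of two exceptional forms with a larger total defect
(`IsRecordShape`). The position of the last defect is governed by an exact loss formula and
d'Ocagne's identity: moving it right increases the index. With a final 1 the value always increases
too; without it, only as long as at most as many blocks `01` precede the defect as follow it. This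
is the condition e ≤ g.

Conversely, among candidates of one length index and value increase together
(`IsRecordShape.run_lt_run`), and all of them beat every shorter word (`IsRecordShape.fib_lt_run`).
The long record-setters therefore form finitely many families `pre uⁱ mid vⁱ wʲ post`, where the
matched exponents express e ≤ g. Such families are context-free, and short words are absorbed as
finitely many exceptions (`LinearPattern.isContextFree_of_long`). -/

/-! ### Words, numbers and the Stern sequence -/

/-- The number obtained by appending the binary digits `w` to `n`. -/
def appendBits (n : ℕ) : List Bool → ℕ
  | [] => n
  | b :: w => appendBits (2 * n + b.toNat) w

/-- Reads the binary digits `w` starting from the pair of consecutive Stern values `(x, y)`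
and returns the first entry of the resulting pair. -/
def run (x y : ℕ) : List Bool → ℕ
  | [] => x
  | false :: w => run x (x + y) w
  | true :: w => run (x + y) y w

theorem appendBits_append (n : ℕ) (u v : List Bool) :
    appendBits n (u ++ v) = appendBits (appendBits n u) v := by
  induction u generalizing n with
  | nil => rfl
  | cons b u ih => exact ih _

theorem stern_appendBits (n : ℕ) (w : List Bool) :
    stern (appendBits n w) = run (stern n) (stern (n + 1)) w := by
  induction w generalizing n with
  | nil => rfl
  | cons b w ih =>
    cases b
    · simp only [appendBits, run, Bool.toNat_false, add_zero, ih, stern_two_mul,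
        stern_two_mul_add_one]
    · have h : 2 * n + 1 + 1 = 2 * (n + 1) := by ring
      simp only [appendBits, run, Bool.toNat_true, ih, h, stern_two_mul, stern_two_mul_add_one]

theorem stern_appendBits_one (w : List Bool) : stern (appendBits 1 w) = run 1 1 w := by
  have h : stern 2 = 1 := by rw [show 2 = 2 * 1 from rfl, stern_two_mul, stern_one]
  rw [stern_appendBits, stern_one, h]

theorem le_appendBits (n : ℕ) (w : List Bool) : n * 2 ^ w.length ≤ appendBits n w := by
  induction w generalizing n with
  | nil => simp [appendBits]
  | cons b w ih =>
    refine le_trans ?_ (ih _)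
    rw [List.length_cons, pow_succ']
    nlinarith [Nat.zero_le (b.toNat * 2 ^ w.length)]

theorem appendBits_lt (n : ℕ) (w : List Bool) : appendBits n w < (n + 1) * 2 ^ w.length := by
  induction w generalizing n with
  | nil => simp [appendBits]
  | cons b w ih =>
    refine lt_of_lt_of_le (ih _) ?_
    rw [List.length_cons, pow_succ', ← mul_assoc]
    refine Nat.mul_le_mul_right _ ?_
    have := Bool.toNat_le b
    omega

theorem appendBits_lt_appendBits (n : ℕ) (u : List Bool) {x y : List Bool}
    (h : x.length = y.length) :
    appendBits n (u ++ false :: x) < appendBits n (u ++ true :: y) := by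
  rw [appendBits_append, appendBits_append]
  refine lt_of_lt_of_le (appendBits_lt _ x) (le_trans ?_ (le_appendBits _ y))
  simp [h]

theorem exists_appendBits {v : ℕ} (hv : v ≠ 0) : ∃ w, v = appendBits 1 w := by
  induction v using Nat.strong_induction_on with
  | _ v ih =>
    rcases Nat.lt_or_ge v 2 with h | h
    · exact ⟨[], by simp only [appendBits]; omega⟩
    · obtain ⟨w, hw⟩ := ih (v / 2) (by omega) (by omega)
      refine ⟨w ++ [decide (v % 2 = 1)], ?_⟩
      rw [appendBits_append, ← hw]
      rcases Nat.mod_two_eq_zero_or_one v with h' | h' <;> simp [appendBits, h'] <;> omega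

theorem binaryRep_appendBits {n : ℕ} (hn : n ≠ 0) (w : List Bool) :
    binaryRep (appendBits n w) = binaryRep n ++ w := by
  induction w generalizing n with
  | nil => simp [appendBits]
  | cons b w ih =>
    have h : 2 * n + b.toNat ≠ 0 := by omega
    rw [appendBits, ih h]
    have : binaryRep (2 * n + b.toNat) = binaryRep n ++ [b] := by
      unfold binaryRep
      cases b
      · simp [Nat.bit0_bits n hn]
      · simp
    simp [this]

theorem binaryRep_appendBits_one (w : List Bool) :
    binaryRep (appendBits 1 w) = true :: w := by
  rw [binaryRep_appendBits one_ne_zero]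
  simp [binaryRep]

/-! ### Upper bounds for the Stern sequence -/

/-- The largest value that can be read off `(x, y)`, where `y ≤ x`, by `n` further digits. -/
def peak (x y n : ℕ) : ℕ := x * Nat.fib (n + 1) + y * Nat.fib n

theorem peak_add_two (x y n : ℕ) : peak x y (n + 2) = peak (2 * x + y) (x + y) n := by
  simp only [peak, Nat.fib_add_two, show n + 2 + 1 = n + 1 + 2 by ring]
  ring

/-- The maximum and minimum make the induction possible, since a digit may reverse the order of the
pair. -/
theorem run_le_peak_max (x y : ℕ) (w : List Bool) :
    run x y w ≤ peak (max x y) (min x y) w.length := by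
  induction w generalizing x y with
  | nil => simp [run, peak]
  | cons b w ih =>
    have h1 := Nat.fib_add_two (n := w.length)
    have h2 := Nat.fib_le_fib_succ (n := w.length)
    have h3 := Nat.fib_le_fib_succ (n := w.length + 1)
    rcases le_total x y with h | h
    · cases b
      · refine le_trans (ih _ _) ?_
        rw [max_eq_right (by omega), min_eq_left (by omega), max_eq_right h, min_eq_left h]
        simp only [peak, List.length_cons]
        nlinarith
      · refine le_trans (ih _ _) ?_
        rw [max_eq_left (by omega), min_eq_right (by omega), max_eq_right h, min_eq_left h]
        simp only [peak, List.length_cons]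
        nlinarith
    · cases b
      · refine le_trans (ih _ _) ?_
        rw [max_eq_right (by omega), min_eq_left (by omega), max_eq_left h, min_eq_right h]
        simp only [peak, List.length_cons]
        nlinarith
      · refine le_trans (ih _ _) ?_
        rw [max_eq_left (by omega), min_eq_right (by omega), max_eq_left h, min_eq_right h]
        simp only [peak, List.length_cons]
        nlinarith

theorem run_le_peak {x y : ℕ} (h : y ≤ x) (w : List Bool) : run x y w ≤ peak x y w.length := by
  simpa [max_eq_left h, min_eq_right h] using run_le_peak_max x y w

/-- The alternating word `0101…` of length `n`, ended by the digit `1` if `n` is odd. -/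
def altWord : ℕ → List Bool
  | 0 => []
  | 1 => [true]
  | n + 2 => false :: true :: altWord n

@[simp] theorem length_altWord : ∀ n, (altWord n).length = n
  | 0 => rfl
  | 1 => rfl
  | n + 2 => by simp [altWord, length_altWord n]

theorem run_altWord : ∀ (x y n : ℕ), run x y (altWord n) = peak x y n
  | x, y, 0 => by simp [altWord, run, peak]
  | x, y, 1 => by simp [altWord, run, peak]
  | x, y, n + 2 => by
    rw [peak_add_two, altWord, run, run, run_altWord]
    congr 1
    ring

/-! ### Words in which all runs of ones but the last have length one -/

/-- The word with the blocks `0 ^ (d + 1) 1`, for `d` in the list, followed by a final `1`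
if `t` holds. -/
def blockWord : List ℕ → Bool → List Bool
  | [], false => []
  | [], true => [true]
  | d :: ds, t => List.replicate (d + 1) false ++ true :: blockWord ds t

theorem run_replicate (x y n : ℕ) (u : List Bool) :
    run x y (List.replicate n false ++ u) = run x (n * x + y) u := by
  induction n generalizing y with
  | zero => simp
  | succ n ih =>
    rw [List.replicate_succ, List.cons_append, run, ih]
    congr 1
    ring

theorem run_block (x y d : ℕ) (u : List Bool) :
    run x y (List.replicate (d + 1) false ++ true :: u) =
      run ((d + 2) * x + y) ((d + 1) * x + y) u := by
  rw [run_replicate, run]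
  congr 1
  ring

theorem run_blockWord_cons (x y d : ℕ) (ds : List ℕ) (t : Bool) :
    run x y (blockWord (d :: ds) t) =
      run ((d + 2) * x + y) ((d + 1) * x + y) (blockWord ds t) := by
  rw [blockWord, run_block]

theorem length_blockWord_cons (d : ℕ) (ds : List ℕ) (t : Bool) :
    (blockWord (d :: ds) t).length = (blockWord ds t).length + d + 2 := by
  simp [blockWord]
  ring

theorem word_cases (w : List Bool) :
    (∃ ds t, w = blockWord ds t) ∨ (∃ u, w = u ++ [false]) ∨
      ∃ ds u, u ≠ [] ∧ w = blockWord ds false ++ true :: u := by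
  -- `n` counts the zeros already read in a block that is still open.
  suffices H : ∀ n, (∃ ds t, List.replicate n false ++ w = blockWord ds t) ∨
      (∃ u, List.replicate n false ++ w = u ++ [false]) ∨
      ∃ ds u, u ≠ [] ∧ List.replicate n false ++ w = blockWord ds false ++ true :: u by
    simpa using H 0
  induction w with
  | nil =>
    rintro (_ | n)
    · exact .inl ⟨[], false, rfl⟩
    · exact .inr (.inl ⟨List.replicate n false, by simp [List.replicate_succ']⟩)
  | cons b w ih =>
    intro n
    cases b
    · have h : List.replicate n false ++ false :: w = List.replicate (n + 1) false ++ w := by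
        simp [List.replicate_succ']
      rw [h]
      exact ih (n + 1)
    · rcases n with _ | n
      · rcases w with _ | ⟨b, w⟩
        · exact .inl ⟨[], true, rfl⟩
        · exact .inr (.inr ⟨[], b :: w, by simp, rfl⟩)
      · rcases ih 0 with ⟨ds, t, h⟩ | ⟨u, h⟩ | ⟨ds, u, hu, h⟩
        · exact .inl ⟨n :: ds, t, by simpa [blockWord] using h⟩
        · refine .inr (.inl ⟨List.replicate (n + 1) false ++ true :: u, ?_⟩)
          simpa using h
        · refine .inr (.inr ⟨n :: ds, u, hu, ?_⟩)
          simpa [blockWord] using h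

/-- Complete blocks leave the larger entry first, so `run_le_peak` applies to whatever follows. -/
theorem run_blockWord_append (x y : ℕ) (h : y ≤ x) (ds : List ℕ) :
    ∃ x' y', y' ≤ x' ∧ ∀ u, run x y (blockWord ds false ++ u) = run x' y' u := by
  induction ds generalizing x y with
  | nil => exact ⟨x, y, h, fun u => rfl⟩
  | cons d ds ih =>
    obtain ⟨x', y', h', H⟩ := ih ((d + 2) * x + y) ((d + 1) * x + y) (by nlinarith)
    refine ⟨x', y', h', fun u => ?_⟩
    rw [← H, blockWord, List.append_assoc, List.cons_append, run_block]

/-! ### Elementary properties of record-setters -/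

theorem IsRecordSetter.run_lt {u x y : List Bool} (h : x.length = y.length)
    (hr : IsRecordSetter stern (appendBits 1 (u ++ true :: y))) :
    run 1 1 (u ++ false :: x) < run 1 1 (u ++ true :: y) := by
  simpa only [stern_appendBits_one] using hr _ (appendBits_lt_appendBits 1 u h)

theorem peak_one_one (n : ℕ) : peak 1 1 n = Nat.fib (n + 2) := by
  simp [peak, Nat.fib_add_two, add_comm]

theorem appendBits_one_lt_of_length_lt {w w' : List Bool} (h : w.length < w'.length) :
    appendBits 1 w < appendBits 1 w' := by
  refine lt_of_lt_of_le (appendBits_lt 1 w) (le_trans ?_ (le_appendBits 1 w'))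
  rw [one_add_one_eq_two, ← pow_succ', one_mul]
  exact Nat.pow_le_pow_right two_pos h

theorem IsRecordSetter.fib_lt {w : List Bool} (hw : w ≠ [])
    (hr : IsRecordSetter stern (appendBits 1 w)) : Nat.fib (w.length + 1) < run 1 1 w := by
  have hl : 0 < w.length := List.length_pos_iff.mpr hw
  have h := hr (appendBits 1 (altWord (w.length - 1)))
    (appendBits_one_lt_of_length_lt (by rw [length_altWord]; omega))
  rw [stern_appendBits_one, stern_appendBits_one, run_altWord, peak_one_one] at h
  rwa [show w.length - 1 + 2 = w.length + 1 by omega] at h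

/-- A final 0 repeats the value of half the index. A 1 at the start of a block, if it is not the
last digit, can be replaced by 0; continuing alternately then attains the peak of the pair reached,
at a smaller index. -/
theorem IsRecordSetter.exists_blockWord {w : List Bool}
    (hr : IsRecordSetter stern (appendBits 1 w)) : ∃ ds t, w = blockWord ds t := by
  rcases word_cases w with h | ⟨u, rfl⟩ | ⟨ds, u, hu, rfl⟩
  · exact h
  · have h := hr (appendBits 1 u) (appendBits_one_lt_of_length_lt (by simp))
    rw [appendBits_append, appendBits, appendBits, Bool.toNat_false, add_zero,
      stern_two_mul] at h
    exact absurd h (lt_irrefl _)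
  · exfalso
    obtain ⟨n, hn⟩ : ∃ n, u.length = n + 1 :=
      Nat.exists_eq_succ_of_ne_zero (by simpa using hu)
    have h := hr.run_lt (x := true :: altWord n) (by simp [hn])
    obtain ⟨x, y, hxy, H⟩ := run_blockWord_append 1 1 le_rfl ds
    have h2 : false :: true :: altWord n = altWord (n + 2) := rfl
    rw [H, H, h2, run_altWord] at h
    have h3 := run_le_peak hxy (true :: u)
    rw [List.length_cons, hn] at h3
    exact absurd h (not_lt_of_ge h3)

/-! ### The loss caused by long blocks -/

theorem fib_add_eq (n : ℕ) :
    Nat.fib (n + 2) = Nat.fib (n + 1) + Nat.fib n ∧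
    Nat.fib (n + 3) = 2 * Nat.fib (n + 1) + Nat.fib n ∧
    Nat.fib (n + 4) = 3 * Nat.fib (n + 1) + 2 * Nat.fib n ∧
    Nat.fib (n + 5) = 5 * Nat.fib (n + 1) + 3 * Nat.fib n ∧
    Nat.fib (n + 6) = 8 * Nat.fib (n + 1) + 5 * Nat.fib n := by
  have h2 := Nat.fib_add_two (n := n)
  have h3 := Nat.fib_add_two (n := n + 1)
  have h4 := Nat.fib_add_two (n := n + 2)
  have h5 := Nat.fib_add_two (n := n + 3)
  have h6 := Nat.fib_add_two (n := n + 4)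
  simp only [add_assoc, Nat.reduceAdd] at h2 h3 h4 h5 h6
  omega

theorem peak_succ_block (x y d n : ℕ) :
    peak ((d + 3) * x + y) ((d + 2) * x + y) n =
      peak ((d + 2) * x + y) ((d + 1) * x + y) n + x * Nat.fib (n + 2) := by
  simp only [peak, Nat.fib_add_two]
  ring

/-- Raising d by one adds x·F(n+2) on the left and at least twice that to the peak on the right, so
the ratio 3/4 persists. The condition 3x ≤ 5y bounds the ratio of the entries and is inherited
through blocks of defect 0 and 1. -/
theorem peak_block_le_of_two_le {x y : ℕ} (h : 3 * x ≤ 5 * y) (d n : ℕ) :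
    4 * peak ((d + 4) * x + y) ((d + 3) * x + y) n ≤ 3 * peak x y (n + d + 4) := by
  induction d with
  | zero =>
    obtain ⟨-, -, h4, h5, -⟩ := fib_add_eq n
    have hab := Nat.fib_le_fib_succ (n := n)
    simp only [peak, zero_add, add_zero, add_assoc, Nat.reduceAdd] at *
    rw [h4, h5]
    nlinarith [Nat.mul_le_mul_right (Nat.fib (n + 1)) h, Nat.mul_le_mul_right (Nat.fib n) h,
      Nat.mul_le_mul_left y hab]
  | succ d ih =>
    have h1 := peak_succ_block x y (d + 2) n
    have h2 : peak x y (n + (d + 1) + 4) = peak x y (n + d + 4) + peak x y (n + d + 3) := by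
      simp only [peak, show n + (d + 1) + 4 = n + d + 3 + 2 by ring,
        show n + d + 3 + 2 + 1 = n + d + 4 + 2 by ring, Nat.fib_add_two]
      ring
    have h3 : 2 * (x * Nat.fib (n + 2)) ≤ peak x y (n + d + 3) := by
      have h4 : Nat.fib (n + 4) ≤ Nat.fib (n + d + 3 + 1) := Nat.fib_mono (by omega)
      obtain ⟨h5, -, h6, -⟩ := fib_add_eq n
      have h7 : 2 * Nat.fib (n + 2) ≤ Nat.fib (n + d + 3 + 1) := by omega
      calc 2 * (x * Nat.fib (n + 2)) = x * (2 * Nat.fib (n + 2)) := by ring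
        _ ≤ x * Nat.fib (n + d + 3 + 1) := Nat.mul_le_mul_left _ h7
        _ ≤ _ := Nat.le_add_right _ _
    rw [h2, show d + 1 + 4 = d + 2 + 3 by ring, show d + 1 + 3 = d + 2 + 2 by ring, h1]
    rw [show d + 2 + 2 = d + 4 by ring, show d + 2 + 1 = d + 3 by ring]
    omega

/-- The difference of the two peaks is y·F(n+1). Its share of the larger one is least when 3x = 5y
and F(n) = F(n+1), where it equals 3/34. -/
theorem peak_block_one_le {x y : ℕ} (h : 3 * x ≤ 5 * y) (n : ℕ) :
    34 * peak (3 * x + y) (2 * x + y) n ≤ 31 * peak x y (n + 3) := by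
  obtain ⟨-, h3, h4, -⟩ := fib_add_eq n
  have hab := Nat.fib_le_fib_succ (n := n)
  simp only [peak, add_assoc, Nat.reduceAdd] at *
  rw [h3, h4]
  nlinarith [Nat.mul_le_mul_right (Nat.fib (n + 1)) h, Nat.mul_le_mul_right (Nat.fib n) h,
      Nat.mul_le_mul_left y hab]

theorem run_blockWord_le_of_one_le_sum {x y : ℕ} (hyx : y ≤ x) (h : 3 * x ≤ 5 * y)
    {ds : List ℕ} (hds : 1 ≤ ds.sum) (t : Bool) :
    34 * run x y (blockWord ds t) ≤ 31 * peak x y (blockWord ds t).length := by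
  induction ds generalizing x y with
  | nil => simp at hds
  | cons d ds ih =>
    rw [run_blockWord_cons, length_blockWord_cons]
    rcases d with _ | _ | d
    · rw [add_zero, peak_add_two]
      have := ih (x := 2 * x + y) (y := x + y) (by omega) (by omega) (by simpa using hds)
      simpa using this
    · have h1 := run_le_peak (x := 3 * x + y) (y := 2 * x + y) (by omega) (blockWord ds t)
      have h2 := peak_block_one_le h (blockWord ds t).length
      norm_num [add_assoc] at *
      omega
    · have h1 := run_le_peak (x := (d + 4) * x + y) (y := (d + 3) * x + y) (by nlinarith)
        (blockWord ds t)
      have h2 := peak_block_le_of_two_le h d (blockWord ds t).length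
      norm_num [add_assoc] at *
      omega

/-- Either one block loses a quarter, or two blocks lose 3/34 each, and (31/34)² < 5/6. -/
theorem run_blockWord_le_of_two_le_sum {x y : ℕ} (hyx : y ≤ x) (h : 3 * x ≤ 5 * y)
    {ds : List ℕ} (hds : 2 ≤ ds.sum) (t : Bool) :
    6 * run x y (blockWord ds t) ≤ 5 * peak x y (blockWord ds t).length := by
  induction ds generalizing x y with
  | nil => simp at hds
  | cons d ds ih =>
    rw [run_blockWord_cons, length_blockWord_cons]
    rcases d with _ | _ | d
    · rw [add_zero, peak_add_two]
      have := ih (x := 2 * x + y) (y := x + y) (by omega) (by omega) (by simpa using hds)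
      simpa using this
    · have h1 := run_blockWord_le_of_one_le_sum (x := 3 * x + y) (y := 2 * x + y)
        (by omega) (by omega) (ds := ds) (by simp at hds; omega) t
      have h2 := peak_block_one_le h (blockWord ds t).length
      norm_num [add_assoc] at *
      omega
    · have h1 := run_le_peak (x := (d + 4) * x + y) (y := (d + 3) * x + y) (by nlinarith)
        (blockWord ds t)
      have h2 := peak_block_le_of_two_le h d (blockWord ds t).length
      norm_num [add_assoc] at *
      omega

/-! ### A single defect -/

/-- The list with a single nonzero entry `1`, preceded by `e` and followed by `g` zeros. -/
def oneDefect (e g : ℕ) : List ℕ := List.replicate e 0 ++ 1 :: List.replicate g 0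

theorem blockWord_replicate (m : ℕ) (t : Bool) :
    blockWord (List.replicate m 0) t = altWord (2 * m + t.toNat) := by
  induction m with
  | zero => cases t <;> rfl
  | succ m ih =>
    rw [show 2 * (m + 1) + t.toNat = 2 * m + t.toNat + 2 by ring, altWord, ← ih]
    rfl

theorem eq_replicate_of_sum_eq_zero {ds : List ℕ} (h : ds.sum = 0) :
    ∃ m, ds = List.replicate m 0 :=
  ⟨ds.length, List.eq_replicate_of_mem (List.sum_eq_zero_iff.mp h)⟩

theorem eq_oneDefect_of_sum_eq_one {ds : List ℕ} (h : ds.sum = 1) :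
    ∃ e g, ds = oneDefect e g := by
  induction ds with
  | nil => simp at h
  | cons d ds ih =>
    rcases d with _ | _ | d
    · obtain ⟨e, g, rfl⟩ := ih (by simpa using h)
      exact ⟨e + 1, g, rfl⟩
    · obtain ⟨m, rfl⟩ := eq_replicate_of_sum_eq_zero (ds := ds) (by simpa using h)
      exact ⟨0, m, rfl⟩
    · simp at h; omega

theorem length_blockWord_oneDefect (e g : ℕ) (t : Bool) :
    (blockWord (oneDefect e g) t).length = 2 * e + 2 * g + t.toNat + 3 := by
  induction e with
  | zero =>
    simp only [oneDefect, List.replicate_zero, List.nil_append, length_blockWord_cons,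
      blockWord_replicate, length_altWord]
    ring
  | succ e ih =>
    rw [show oneDefect (e + 1) g = 0 :: oneDefect e g from rfl, length_blockWord_cons, ih]
    ring

/-- A block `01` sends (u, y) to (u+y, u+2y), which shifts the Fibonacci coefficients of the loss by
two indices. -/
theorem run_oneDefect_add (u y e g : ℕ) (t : Bool) :
    run (u + y) y (blockWord (oneDefect e g) t) +
      (u * Nat.fib (2 * e) + y * Nat.fib (2 * e + 1)) * Nat.fib (2 * g + t.toNat + 1) =
    peak (u + y) y (2 * e + 2 * g + t.toNat + 3) := by
  induction e generalizing u y with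
  | zero =>
    rw [show oneDefect 0 g = 1 :: List.replicate g 0 from rfl, run_blockWord_cons,
      blockWord_replicate, run_altWord]
    obtain ⟨-, h3, h4, -⟩ := fib_add_eq (2 * g + t.toNat)
    simp only [peak, mul_zero, zero_add, Nat.fib_zero, Nat.fib_one]
    simp only [add_assoc, Nat.reduceAdd] at *
    rw [h3, h4]
    ring
  | succ e ih =>
    rw [show oneDefect (e + 1) g = 0 :: oneDefect e g from rfl, run_blockWord_cons]
    have h := ih (u + y) (u + 2 * y)
    rw [show 2 * (e + 1) + 2 * g + t.toNat + 3 = 2 * e + 2 * g + t.toNat + 3 + 2 by ring,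
      peak_add_two, show 2 * (u + y) + y = u + y + (u + 2 * y) by ring,
      show u + y + y = u + 2 * y by ring, ← h]
    have h2 : 2 * (e + 1) = 2 * e + 2 := by ring
    obtain ⟨h3, h4, -⟩ := fib_add_eq (2 * e)
    rw [h2, show 2 * e + 2 + 1 = 2 * e + 3 by ring, h3, h4]
    rw [show (0 + 1) * (u + y) + y = u + 2 * y by ring]
    ring

/-! ### Moving a defect -/

/-- D'Ocagne's identity; the parity of the indices is fixed so that the sign is known and no
subtraction is needed. -/
theorem fib_docagne (i j : ℕ) :
    Nat.fib (2 * i + j + 1) * Nat.fib (2 * i) + Nat.fib j =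
        Nat.fib (2 * i + j) * Nat.fib (2 * i + 1) ∧
      Nat.fib (2 * i + j + 1) * Nat.fib (2 * i + 2) + Nat.fib j =
        Nat.fib (2 * i + j + 2) * Nat.fib (2 * i + 1) := by
  induction i with
  | zero => simp [Nat.fib_add_two, add_comm]
  | succ i ih =>
    obtain ⟨h1, h2, -⟩ := fib_add_eq (2 * i + j)
    obtain ⟨h4, h5, h6, -⟩ := fib_add_eq (2 * i)
    obtain ⟨-, -, h7, -⟩ := fib_add_eq (2 * i + j)
    rw [show 2 * (i + 1) + j + 1 = 2 * i + j + 3 by ring,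
      show 2 * (i + 1) + j + 2 = 2 * i + j + 4 by ring,
      show 2 * (i + 1) + j = 2 * i + j + 2 by ring,
      show 2 * (i + 1) + 1 = 2 * i + 3 by ring,
      show 2 * (i + 1) + 2 = 2 * i + 4 by ring,
      show 2 * (i + 1) = 2 * i + 2 by ring]
    rw [h1, h4] at ih
    rw [h1, h2, h4, h5, h6, h7]
    constructor <;> nlinarith [ih.1, ih.2]

theorem fib_le_two_mul_fib {n : ℕ} (hn : 1 ≤ n) : Nat.fib (n + 1) ≤ 2 * Nat.fib n := by
  obtain ⟨m, rfl⟩ := Nat.exists_eq_add_of_le' hn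
  have h1 := Nat.fib_add_two (n := m)
  have h2 := Nat.fib_le_fib_succ (n := m)
  rw [show m + 1 + 1 = m + 2 by ring]
  omega

theorem three_mul_fib_le {n : ℕ} (hn : n ≠ 1) : 3 * Nat.fib n ≤ 2 * Nat.fib (n + 1) := by
  rcases n with _ | _ | m
  · simp
  · exact absurd rfl hn
  · obtain ⟨h1, h2, -⟩ := fib_add_eq m
    have h3 := Nat.fib_le_fib_succ (n := m)
    rw [show m + 1 + 1 + 1 = m + 3 by ring, show m + 1 + 1 = m + 2 by ring]
    omega

/-- The quantity by which the word with a single defect falls short of the peak. -/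
def loss (u y e n : ℕ) : ℕ := (u * Nat.fib (2 * e) + y * Nat.fib (2 * e + 1)) * Nat.fib n

/-- This writes the change of loss under a shift of the defect by one block as u and y times two
differences of Fibonacci products, each evaluated by `fib_docagne`. -/
theorem loss_add_loss (u y e n : ℕ) :
    loss u y e (n + 2) + u * (Nat.fib (2 * e + 1) * Nat.fib n) +
        y * (Nat.fib (2 * e + 2) * Nat.fib n) =
      loss u y (e + 1) n + u * (Nat.fib (2 * e) * Nat.fib (n + 1)) +
        y * (Nat.fib (2 * e + 1) * Nat.fib (n + 1)) := by
  obtain ⟨h1, h2, -⟩ := fib_add_eq (2 * e)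
  rw [loss, loss, show 2 * (e + 1) + 1 = 2 * e + 3 by ring,
    show 2 * (e + 1) = 2 * e + 2 by ring, h1, h2, Nat.fib_add_two]
  ring

theorem loss_odd_le {u y e g : ℕ} (h : g ≤ e) :
    loss u y e (2 * g + 3) ≤ loss u y (e + 1) (2 * g + 1) := by
  have H := loss_add_loss u y e (2 * g + 1)
  obtain ⟨j, rfl⟩ := Nat.exists_eq_add_of_le h
  have h1 := (fib_docagne g (2 * j)).2
  have h2 : Nat.fib (2 * (g + j)) * Nat.fib (2 * g + 1 + 1) ≤
      Nat.fib (2 * (g + j) + 1) * Nat.fib (2 * g + 1) := by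
    rcases j with _ | j
    · have := (fib_docagne g 1).1
      norm_num [add_assoc] at this ⊢
      nlinarith
    · have := (fib_docagne g (2 * j + 1)).2
      rw [show 2 * g + (2 * j + 1) + 1 = 2 * (g + (j + 1)) by ring,
        show 2 * g + (2 * j + 1) + 2 = 2 * (g + (j + 1)) + 1 by ring] at this
      rw [show 2 * g + 1 + 1 = 2 * g + 2 by ring]
      omega
  rw [show 2 * g + 2 * j + 1 = 2 * (g + j) + 1 by ring,
    show 2 * g + 2 * j + 2 = 2 * (g + j) + 2 by ring] at h1
  have h3 := Nat.mul_le_mul_left u h2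
  have h4 : y * (Nat.fib (2 * (g + j) + 1) * Nat.fib (2 * g + 1 + 1)) ≤
      y * (Nat.fib (2 * (g + j) + 2) * Nat.fib (2 * g + 1)) :=
    Nat.mul_le_mul_left y (by rw [← h1]; exact Nat.le_add_right _ _)
  rw [show 2 * g + 1 + 2 = 2 * g + 3 by ring] at H
  omega

/-- With g = e+j+1 the gain is y·F(2j+2) − u·F(2j+3), and F(2j+3) ≤ 2·F(2j+2); hence the condition
2u < y. -/
theorem loss_odd_lt {u y e g : ℕ} (huy : 2 * u < y) (h : e < g) :
    loss u y (e + 1) (2 * g + 1) < loss u y e (2 * g + 3) := by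
  have H := loss_add_loss u y e (2 * g + 1)
  obtain ⟨j, rfl⟩ := Nat.exists_eq_add_of_lt h
  have h1 := (fib_docagne e (2 * j + 2)).2
  have h2 := (fib_docagne e (2 * j + 3)).1
  have h3 : Nat.fib (2 * j + 3) ≤ 2 * Nat.fib (2 * j + 2) := fib_le_two_mul_fib (by omega)
  have h4 : 0 < Nat.fib (2 * j + 2) := Nat.fib_pos.mpr (by omega)
  rw [show 2 * e + (2 * j + 2) + 1 = 2 * (e + j + 1) + 1 by ring,
    show 2 * e + (2 * j + 2) + 2 = 2 * (e + j + 1) + 1 + 1 by ring] at h1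
  rw [show 2 * e + (2 * j + 3) + 1 = 2 * (e + j + 1) + 1 + 1 by ring,
    show 2 * e + (2 * j + 3) = 2 * (e + j + 1) + 1 by ring] at h2
  rw [show 2 * (e + j + 1) + 1 + 2 = 2 * (e + j + 1) + 3 by ring] at H
  nlinarith

/-- The final 1 changes the parity of the second index, so the coefficient of y in the gain is
positive on both sides of e = g. -/
theorem loss_even_lt {u y e g : ℕ} (huy : 2 * u < y) :
    loss u y (e + 1) (2 * g + 2) < loss u y e (2 * g + 4) := by
  have H := loss_add_loss u y e (2 * g + 2)
  rw [show 2 * g + 2 + 2 = 2 * g + 4 by ring] at H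
  rcases Nat.lt_or_ge g e with h | h
  · obtain ⟨j, rfl⟩ := Nat.exists_eq_add_of_lt h
    have h1 := (fib_docagne (g + 1) (2 * j)).1
    have h2 := (fib_docagne (g + 1) (2 * j + 1)).1
    have h4 : 0 < Nat.fib (2 * j + 1) := Nat.fib_pos.mpr (by omega)
    rw [show 2 * (g + 1) + 2 * j + 1 = 2 * (g + j + 1) + 1 by ring,
      show 2 * (g + 1) + 2 * j = 2 * (g + j + 1) by ring,
      show 2 * (g + 1) = 2 * g + 2 by ring] at h1
    rw [show 2 * (g + 1) + (2 * j + 1) + 1 = 2 * (g + j + 1) + 2 by ring,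
      show 2 * (g + 1) + (2 * j + 1) = 2 * (g + j + 1) + 1 by ring,
      show 2 * (g + 1) = 2 * g + 2 by ring] at h2
    nlinarith
  · obtain ⟨j, rfl⟩ := Nat.exists_eq_add_of_le h
    have h1 := (fib_docagne e (2 * j + 2)).1
    have h2 := (fib_docagne e (2 * j + 1)).2
    have h3 : Nat.fib (2 * j + 2) ≤ 2 * Nat.fib (2 * j + 1) := fib_le_two_mul_fib (by omega)
    have h4 : 0 < Nat.fib (2 * j + 1) := Nat.fib_pos.mpr (by omega)
    rw [show 2 * e + (2 * j + 2) + 1 = 2 * (e + j) + 2 + 1 by ring,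
      show 2 * e + (2 * j + 2) = 2 * (e + j) + 2 by ring] at h1
    rw [show 2 * e + (2 * j + 1) + 1 = 2 * (e + j) + 2 by ring,
      show 2 * e + (2 * j + 1) + 2 = 2 * (e + j) + 2 + 1 by ring] at h2
    nlinarith

theorem run_oneDefect_add_loss (u y e g : ℕ) (t : Bool) :
    run (u + y) y (blockWord (oneDefect e g) t) + loss u y e (2 * g + t.toNat + 1) =
      peak (u + y) y (2 * e + 2 * g + t.toNat + 3) :=
  run_oneDefect_add u y e g t

theorem run_oneDefect_le (u y : ℕ) {e g : ℕ} (h : g ≤ e) :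
    run (u + y) y (blockWord (oneDefect (e + 1) g) false) ≤
      run (u + y) y (blockWord (oneDefect e (g + 1)) false) := by
  have h1 := run_oneDefect_add_loss u y (e + 1) g false
  have h2 := run_oneDefect_add_loss u y e (g + 1) false
  have h3 := loss_odd_le (u := u) (y := y) h
  rw [show 2 * (e + 1) + 2 * g = 2 * e + 2 * (g + 1) by ring] at h1
  simp only [Bool.toNat_false, add_zero] at h1 h2
  rw [show 2 * (g + 1) + 1 = 2 * g + 3 by ring] at h2
  omega

theorem run_oneDefect_lt_succ {u y : ℕ} (huy : 2 * u < y) {e g : ℕ} {t : Bool}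
    (h : t = true ∨ e < g) :
    run (u + y) y (blockWord (oneDefect e (g + 1)) t) <
      run (u + y) y (blockWord (oneDefect (e + 1) g) t) := by
  have h1 := run_oneDefect_add_loss u y (e + 1) g t
  have h2 := run_oneDefect_add_loss u y e (g + 1) t
  rw [show 2 * (e + 1) + 2 * g = 2 * e + 2 * (g + 1) by ring] at h1
  cases t
  · have h3 := loss_odd_lt huy (by simpa using h)
    simp only [Bool.toNat_false, add_zero] at h1 h2
    rw [show 2 * (g + 1) + 1 = 2 * g + 3 by ring] at h2
    omega
  · have h3 := loss_even_lt (e := e) (g := g) huy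
    simp only [Bool.toNat_true] at h1 h2
    rw [show 2 * (g + 1) + 1 + 1 = 2 * g + 4 by ring] at h2
    rw [show 2 * g + 1 + 1 = 2 * g + 2 by ring] at h1
    omega

theorem run_oneDefect_lt {u y : ℕ} (huy : 2 * u < y) {e g e' g' : ℕ} {t : Bool}
    (h : t = true ∨ e' ≤ g') (hs : e + g = e' + g') (he : e < e') :
    run (u + y) y (blockWord (oneDefect e g) t) <
      run (u + y) y (blockWord (oneDefect e' g') t) := by
  obtain ⟨j, rfl⟩ := Nat.exists_eq_add_of_lt he
  induction j generalizing g' with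
  | zero =>
    obtain rfl : g = g' + 1 := by omega
    exact run_oneDefect_lt_succ huy (h.imp_right fun h => by omega)
  | succ j ih =>
    refine lt_trans (ih (g' := g' + 1) (h.imp_right fun h => by omega) (by omega) (by omega)) ?_
    exact run_oneDefect_lt_succ huy (h.imp_right fun h => by omega)

theorem blockWord_append (ds es : List ℕ) (t : Bool) :
    blockWord (ds ++ es) t = blockWord ds false ++ blockWord es t := by
  induction ds with
  | nil => rfl
  | cons d ds ih => simp [blockWord, ih]

/-- Moving the defect right replaces `00101` by `01001`, so the second digit of this factor rises
from 0 to 1. -/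
theorem blockWord_oneDefect_succ (p : List ℕ) (e g : ℕ) (t : Bool) :
    ∃ u x y, x.length = y.length ∧
      blockWord (p ++ oneDefect e (g + 1)) t = u ++ false :: x ∧
      blockWord (p ++ oneDefect (e + 1) g) t = u ++ true :: y := by
  refine ⟨blockWord (p ++ List.replicate e 0) false ++ [false],
    true :: false :: true :: altWord (2 * g + t.toNat),
    false :: false :: true :: altWord (2 * g + t.toNat), by simp, ?_, ?_⟩
  · rw [oneDefect, ← List.append_assoc, blockWord_append, List.append_assoc, List.replicate_succ]
    simp only [blockWord, blockWord_replicate]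
    rfl
  · rw [oneDefect, ← List.append_assoc, List.replicate_succ', ← List.append_assoc,
      List.append_assoc _ [0], blockWord_append, List.append_assoc]
    simp only [blockWord, blockWord_replicate, List.singleton_append]
    rfl

/-! ### The record-setters of large length -/

/-- The block sequences of the Stern record-setters with at least twelve binary digits. -/
inductive IsRecordShape : List ℕ → Bool → Prop
  | double (m : ℕ) (t : Bool) : IsRecordShape (2 :: List.replicate m 0) t
  | triple (e : ℕ) : IsRecordShape (1 :: 1 :: oneDefect e 0) true
  | pair (e g : ℕ) (t : Bool) (h : t = true ∨ e ≤ g) : IsRecordShape (1 :: oneDefect e g) t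
  | single (e g : ℕ) (t : Bool) (h : t = true ∨ e ≤ g) : IsRecordShape (oneDefect e g) t
  | none (m : ℕ) (t : Bool) : IsRecordShape (List.replicate m 0) t

/-- If e > g and there is no final 1, moving the defect one block to the left lowers the index
without lowering the value. -/
theorem IsRecordSetter.oneDefect_cond {p : List ℕ} {u y e g : ℕ} {t : Bool}
    (hp : ∀ w, run 1 1 (blockWord p false ++ w) = run (u + y) y w)
    (hr : IsRecordSetter stern (appendBits 1 (blockWord (p ++ oneDefect e g) t))) :
    t = true ∨ e ≤ g := by
  by_contra! h
  obtain ⟨ht, hge⟩ := h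
  obtain rfl : t = false := by simpa using ht
  obtain ⟨e, rfl⟩ := Nat.exists_eq_add_of_lt hge
  obtain ⟨v, x, z, hl, h1, h2⟩ := blockWord_oneDefect_succ p (g + e) g false
  rw [h2] at hr
  have h3 := hr.run_lt hl
  rw [← h1, ← h2, blockWord_append, blockWord_append, hp, hp] at h3
  exact absurd h3 (not_lt_of_ge (run_oneDefect_le u y (by omega)))

/-- The pairs (5, 4) and (15, 11) are reached after `0001` and `001001`. The added terms are the
margin that a third defect may consume before `0001` with an alternating continuation does as well.
-/
theorem add_add_peak (M : ℕ) :
    peak 5 4 (M + 2) + Nat.fib (M + 1) + 2 * Nat.fib M = peak 15 11 M := by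
  obtain ⟨h2, h3, -⟩ := fib_add_eq M
  simp only [peak, show M + 2 + 1 = M + 3 by ring, h2, h3]
  ring

theorem fib_two_mul_add_three_add (e n : ℕ) :
    Nat.fib (2 * e + n + 3 + 1) + 2 * Nat.fib (2 * e + n + 3) =
      (3 * Nat.fib (2 * e) + 4 * Nat.fib (2 * e + 1)) * Nat.fib n +
        (4 * Nat.fib (2 * e) + 7 * Nat.fib (2 * e + 1)) * Nat.fib (n + 1) := by
  have h1 := Nat.fib_add (2 * e + 2) n
  have h2 := Nat.fib_add (2 * e + 3) n
  obtain ⟨h3, h4, h5, -⟩ := fib_add_eq (2 * e)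
  rw [show 2 * e + 2 + n + 1 = 2 * e + n + 3 by ring, show 2 * e + 2 + 1 = 2 * e + 3 by ring,
    h3, h4] at h1
  rw [show 2 * e + 3 + n + 1 = 2 * e + n + 3 + 1 by ring, show 2 * e + 3 + 1 = 2 * e + 4 by ring,
    h4, h5] at h2
  rw [h1, h2]
  ring

/-- With A = F(2e), B = F(2e+1), p = F(2g+t), q = F(2g+t+1), the loss exceeds the margin once
(3A+4B)p ≤ 4Bq. This follows from 3A ≤ 2B and 3p ≤ 2q; the latter fails only at index 1, which is
the exceptional triple shape. -/
theorem run_triple_le {e g : ℕ} {t : Bool} (h : 2 * g + t.toNat ≠ 1) :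
    run 15 11 (blockWord (oneDefect e g) t) ≤
      peak 5 4 ((blockWord (oneDefect e g) t).length + 2) := by
  have h1 : run 15 11 (blockWord (oneDefect e g) t) + loss 4 11 e (2 * g + t.toNat + 1) =
      peak 15 11 (2 * e + 2 * g + t.toNat + 3) := run_oneDefect_add_loss 4 11 e g t
  rw [length_blockWord_oneDefect]
  have h2 := add_add_peak (2 * e + 2 * g + t.toNat + 3)
  have h3 := fib_two_mul_add_three_add e (2 * g + t.toNat)
  have h4 := three_mul_fib_le h
  have h5 := three_mul_fib_le (n := 2 * e) (by omega)
  have h6 : (3 * Nat.fib (2 * e) + 4 * Nat.fib (2 * e + 1)) * Nat.fib (2 * g + t.toNat) +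
        (4 * Nat.fib (2 * e) + 7 * Nat.fib (2 * e + 1)) * Nat.fib (2 * g + t.toNat + 1) ≤
      loss 4 11 e (2 * g + t.toNat + 1) := by
    unfold loss
    nlinarith [Nat.mul_le_mul_left (Nat.fib (2 * e)) h4,
      Nat.mul_le_mul_left (Nat.fib (2 * e + 1)) h4,
      Nat.mul_le_mul_right (Nat.fib (2 * g + t.toNat + 1)) h5]
  rw [← add_assoc (2 * e)] at h3
  omega

/-- The two sides differ by 3·F(2e). They agree at e = 0, a word of length 10, which the length
bound 11 excludes. -/
theorem lt_run_triple {e : ℕ} (he : 1 ≤ e) :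
    peak 5 4 (2 * e + 6) < run 15 11 (blockWord (oneDefect e 0) true) := by
  have h1 : _ = peak 15 11 (2 * e + 4) := run_oneDefect_add_loss 4 11 e 0 true
  have h2 := add_add_peak (2 * e + 4)
  have h3 := fib_two_mul_add_three_add e 1
  have h4 : 0 < Nat.fib (2 * e) := Nat.fib_pos.mpr (by omega)
  have h5 : loss 4 11 e (2 * 0 + true.toNat + 1) =
      4 * Nat.fib (2 * e) + 11 * Nat.fib (2 * e + 1) := by simp [loss]
  rw [h5] at h1
  simp only [add_assoc, Nat.reduceAdd, Nat.fib_one, Nat.fib_two, mul_one] at *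
  omega

/-- A first block with at least four zeros cannot beat the maximum over shorter words. -/
theorem peak_le_fib (d n : ℕ) : peak (d + 6) (d + 5) n ≤ Nat.fib (n + d + 6) := by
  induction d with
  | zero =>
    obtain ⟨-, -, -, -, h⟩ := fib_add_eq n
    simp only [peak, zero_add, add_zero, h]
    omega
  | succ d ih =>
    have h1 : Nat.fib (n + 2) ≤ Nat.fib (n + d + 5) := Nat.fib_mono (by omega)
    have h2 := Nat.fib_add_two (n := n)
    have h3 := Nat.fib_add_two (n := n + d + 5)
    rw [show n + d + 5 + 2 = n + (d + 1) + 6 by ring,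
      show n + d + 5 + 1 = n + d + 6 by ring] at h3
    simp only [peak] at *
    nlinarith

theorem IsRecordSetter.isRecordShape {ds : List ℕ} {t : Bool}
    (hl : 11 ≤ (blockWord ds t).length)
    (hr : IsRecordSetter stern (appendBits 1 (blockWord ds t))) : IsRecordShape ds t := by
  rcases ds with _ | ⟨_ | _ | _ | d, ds⟩
  · exact .none 0 t
  · rw [length_blockWord_cons] at hl
    rcases Nat.lt_or_ge ds.sum 2 with hs | hs
    · rcases (by omega : ds.sum = 0 ∨ ds.sum = 1) with hs | hs
      · obtain ⟨m, rfl⟩ := eq_replicate_of_sum_eq_zero hs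
        exact .none (m + 1) t
      · obtain ⟨e, g, rfl⟩ := eq_oneDefect_of_sum_eq_one hs
        exact .single (e + 1) g t
          (hr.oneDefect_cond (p := []) (u := 0) (y := 1) (e := e + 1) fun w => rfl)
    · exfalso
      obtain ⟨M, hM⟩ : ∃ M, (blockWord ds t).length = M + 1 :=
        Nat.exists_eq_add_of_le' (by omega)
      -- The competitor is `001` continued alternately, from the pair (4, 3).
      have h1 := IsRecordSetter.run_lt (u := [false]) (x := true :: altWord M)
        (y := blockWord ds t) (by simp [hM]) hr
      simp only [List.singleton_append, run, run_altWord] at h1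
      have h2 := run_blockWord_le_of_two_le_sum (x := 3) (y := 2) (by omega) (by omega) hs t
      have h3 := fib_le_two_mul_fib (n := M) (by omega)
      have h4 := Nat.fib_add_two (n := M)
      rw [hM] at h2
      norm_num [peak, add_assoc] at *
      omega
  · rw [length_blockWord_cons] at hl
    rcases Nat.eq_zero_or_pos ds.sum with hs | hs
    · obtain ⟨m, rfl⟩ := eq_replicate_of_sum_eq_zero hs
      exact .single 0 m t (.inr (Nat.zero_le _))
    rcases ds with _ | ⟨_ | _ | d, ds⟩
    · simp at hs
    · rw [length_blockWord_cons] at hl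
      rcases Nat.lt_or_ge ds.sum 2 with hs' | hs'
      · have hs' : ds.sum = 1 := by simp at hs; omega
        obtain ⟨e, g, rfl⟩ := eq_oneDefect_of_sum_eq_one hs'
        exact .pair (e + 1) g t
          (hr.oneDefect_cond (p := [1]) (u := 1) (y := 3) (e := e + 1) fun w => rfl)
      · exfalso
        obtain ⟨M, hM⟩ : ∃ M, (blockWord ds t).length = M + 1 :=
          Nat.exists_eq_add_of_le' (by omega)
        -- The competitor is `001001` continued alternately, from the pair (15, 11).
        have h1 := IsRecordSetter.run_lt (u := [false, false, true, false])
          (x := true :: altWord M) (y := blockWord ds t) (by simp [hM]) hr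
        simp only [List.cons_append, List.nil_append, run, run_altWord] at h1
        have h2 := run_blockWord_le_of_two_le_sum (x := 11) (y := 7) (by omega) (by omega) hs' t
        have h4 := Nat.fib_add_two (n := M)
        rw [hM] at h2
        norm_num [peak, add_assoc] at *
        omega
    · rw [length_blockWord_cons] at hl
      rcases Nat.eq_zero_or_pos ds.sum with hs' | hs'
      · obtain ⟨m, rfl⟩ := eq_replicate_of_sum_eq_zero hs'
        exact .pair 0 m t (.inr (Nat.zero_le _))
      -- The competitor is `0001` continued alternately, from the pair (5, 4).
      have h1 := IsRecordSetter.run_lt (u := [false, false])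
        (x := true :: altWord ((blockWord ds t).length + 2))
        (y := false :: false :: true :: blockWord ds t) (by simp) hr
      simp only [List.cons_append, List.nil_append, run, run_altWord] at h1
      norm_num at h1
      rcases Nat.lt_or_ge ds.sum 2 with hs'' | hs''
      · obtain ⟨e, g, rfl⟩ := eq_oneDefect_of_sum_eq_one (by omega : ds.sum = 1)
        by_cases hg : 2 * g + t.toNat = 1
        · obtain ⟨rfl, rfl⟩ : g = 0 ∧ t = true := by
            cases t <;> simp at hg ⊢; omega
          exact .triple e
        · exact absurd h1 (not_lt_of_ge (run_triple_le hg))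
      · exfalso
        have h2 := run_blockWord_le_of_two_le_sum (x := 15) (y := 11) (by omega) (by omega)
          hs'' t
        have h3 := add_add_peak (blockWord ds t).length
        have h4 := Nat.fib_le_fib_succ (n := (blockWord ds t).length)
        simp only [peak] at *
        omega
    · exfalso
      obtain ⟨M, hM⟩ : ∃ M, (blockWord ((d + 1 + 1) :: ds) t).length = M + 1 :=
        Nat.exists_eq_add_of_le' (by omega)
      have h1 := IsRecordSetter.run_lt (u := [false, false]) (x := true :: altWord M)
        (y := blockWord ((d + 1 + 1) :: ds) t) (by simp [hM]) hr
      simp only [List.cons_append, List.nil_append, run, run_altWord] at h1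
      rw [run_blockWord_cons, show (d + 1 + 1 + 2) * 4 + 3 = (d + 4) * 4 + 3 by ring,
        show (d + 1 + 1 + 1) * 4 + 3 = (d + 3) * 4 + 3 by ring] at h1
      norm_num at h1
      have h2 := peak_block_le_of_two_le (x := 4) (y := 3) (by omega) d (blockWord ds t).length
      have h3 := run_le_peak (x := (d + 4) * 4 + 3) (y := (d + 3) * 4 + 3) (by omega)
        (blockWord ds t)
      have h4 := Nat.fib_add_two (n := M)
      have h5 := fib_le_two_mul_fib (n := M) (by omega)
      rw [length_blockWord_cons] at hM
      rw [show (blockWord ds t).length + d + 4 = M + 1 by omega] at h2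
      norm_num [peak, add_assoc] at *
      omega
  · rw [length_blockWord_cons] at hl
    rcases Nat.eq_zero_or_pos ds.sum with hs | hs
    · obtain ⟨m, rfl⟩ := eq_replicate_of_sum_eq_zero hs
      exact .double m t
    · exfalso
      -- Here the maximum over words one digit shorter suffices as competitor.
      have h1 := hr.fib_lt (by rintro h; simp [blockWord] at h)
      rw [run_blockWord_cons, length_blockWord_cons] at h1
      norm_num at h1
      have h2 := run_blockWord_le_of_one_le_sum (x := 5) (y := 4) (by omega) (by omega) hs t
      obtain ⟨-, -, -, h3, -⟩ := fib_add_eq (blockWord ds t).length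
      have h4 := three_mul_fib_le (n := (blockWord ds t).length) (by omega)
      norm_num [peak, add_assoc] at *
      omega
  · exfalso
    have h1 := hr.fib_lt (by rintro h; simp [blockWord, List.replicate_succ] at h)
    rw [run_blockWord_cons, length_blockWord_cons] at h1
    have h2 := run_le_peak (x := (d + 5) * 1 + 1) (y := (d + 4) * 1 + 1) (by omega)
      (blockWord ds t)
    have h3 := peak_le_fib d (blockWord ds t).length
    norm_num [add_assoc] at *
    omega

/-! ### Comparing the candidate shapes -/

/-- At the first differing block, the one with more zeros still shows 0 where the other shows its 1.
-/
theorem appendBits_blockWord_lt (p : List ℕ) {a b : ℕ} (hab : b < a) (ds es : List ℕ) (t s : Bool)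
    (hl : (blockWord (p ++ a :: ds) t).length = (blockWord (p ++ b :: es) s).length) :
    appendBits 1 (blockWord (p ++ a :: ds) t) < appendBits 1 (blockWord (p ++ b :: es) s) := by
  obtain ⟨c, rfl⟩ := Nat.exists_eq_add_of_lt hab
  have h1 : blockWord (p ++ (b + c + 1) :: ds) t =
      (blockWord p false ++ List.replicate (b + 1) false) ++
        false :: (List.replicate c false ++ true :: blockWord ds t) := by
    rw [blockWord_append, blockWord, show b + c + 1 + 1 = b + 1 + (c + 1) by ring,
      List.replicate_add, List.replicate_succ (n := c)]
    simp
  have h2 : blockWord (p ++ b :: es) s =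
      (blockWord p false ++ List.replicate (b + 1) false) ++ true :: blockWord es s := by
    rw [blockWord_append, blockWord, List.append_assoc]
  rw [h1, h2] at hl ⊢
  refine appendBits_lt_appendBits 1 _ ?_
  simp only [List.length_append, List.length_cons] at hl ⊢
  omega

theorem loss_pos (u : ℕ) {y e n : ℕ} (hy : 0 < y) (hn : 0 < n) : 0 < loss u y e n :=
  Nat.mul_pos (Nat.add_pos_right _ (Nat.mul_pos hy (Nat.fib_pos.mpr (by omega))))
    (Nat.fib_pos.mpr hn)

theorem length_blockWord_replicate (m : ℕ) (t : Bool) :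
    (blockWord (List.replicate m 0) t).length = 2 * m + t.toNat := by
  rw [blockWord_replicate, length_altWord]

theorem run_oneDefect_lt_peak (u : ℕ) {y : ℕ} (hy : 0 < y) (e g : ℕ) (t : Bool) :
    run (u + y) y (blockWord (oneDefect e g) t) <
      peak (u + y) y (2 * e + 2 * g + t.toNat + 3) := by
  have h1 := run_oneDefect_add_loss u y e g t
  have h2 := loss_pos u (e := e) (n := 2 * g + t.toNat + 1) hy (by omega)
  omega

/-- The leftmost position of the defect has the least value, and there only an alternating word
follows the block `001`. -/
theorem peak_le_run_oneDefect {u y : ℕ} (huy : 2 * u < y) {e g : ℕ} {t : Bool}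
    (h : t = true ∨ e ≤ g) :
    peak (3 * (u + y) + y) (2 * (u + y) + y) (2 * e + 2 * g + t.toNat) ≤
      run (u + y) y (blockWord (oneDefect e g) t) := by
  have h1 : run (u + y) y (blockWord (oneDefect 0 (e + g)) t) =
      peak (3 * (u + y) + y) (2 * (u + y) + y) (2 * e + 2 * g + t.toNat) := by
    rw [show oneDefect 0 (e + g) = 1 :: List.replicate (e + g) 0 from rfl, run_blockWord_cons,
      blockWord_replicate, run_altWord]
    congr 1
    ring
  rw [← h1]
  rcases Nat.eq_zero_or_pos e with rfl | he
  · rw [zero_add]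
  · exact (run_oneDefect_lt huy h (by omega) he).le

theorem run_double {n m : ℕ} {t : Bool}
    (hl : (blockWord (2 :: List.replicate m 0) t).length = n + 6) :
    run 1 1 (blockWord (2 :: List.replicate m 0) t) = peak 5 4 (n + 2) := by
  rw [length_blockWord_cons, length_blockWord_replicate] at hl
  rw [run_blockWord_cons, blockWord_replicate, run_altWord]
  congr 1
  omega

theorem run_triple_mem {n e : ℕ} (hn : 5 ≤ n)
    (hl : (blockWord (1 :: 1 :: oneDefect e 0) true).length = n + 6) :
    peak 5 4 (n + 2) < run 1 1 (blockWord (1 :: 1 :: oneDefect e 0) true) ∧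
      run 1 1 (blockWord (1 :: 1 :: oneDefect e 0) true) < peak 15 11 n := by
  rw [length_blockWord_cons, length_blockWord_cons, length_blockWord_oneDefect,
    Bool.toNat_true] at hl
  rw [run_blockWord_cons, run_blockWord_cons]
  obtain rfl : n = 2 * e + 4 := by omega
  exact ⟨lt_run_triple (by omega), run_oneDefect_lt_peak 4 (y := 11) (by norm_num) e 0 true⟩

theorem run_pair_mem {n e g : ℕ} {t : Bool} (h : t = true ∨ e ≤ g)
    (hl : (blockWord (1 :: oneDefect e g) t).length = n + 6) :
    peak 15 11 n ≤ run 1 1 (blockWord (1 :: oneDefect e g) t) ∧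
      run 1 1 (blockWord (1 :: oneDefect e g) t) < peak 4 3 (n + 3) := by
  rw [length_blockWord_cons, length_blockWord_oneDefect] at hl
  rw [run_blockWord_cons]
  obtain rfl : n = 2 * e + 2 * g + t.toNat := by omega
  exact ⟨peak_le_run_oneDefect (u := 1) (y := 3) (by norm_num) h,
    run_oneDefect_lt_peak 1 (y := 3) (by norm_num) e g t⟩

theorem run_single_mem {n e g : ℕ} {t : Bool} (h : t = true ∨ e ≤ g)
    (hl : (blockWord (oneDefect e g) t).length = n + 6) :
    peak 4 3 (n + 3) ≤ run 1 1 (blockWord (oneDefect e g) t) ∧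
      run 1 1 (blockWord (oneDefect e g) t) < peak 1 1 (n + 6) := by
  rw [length_blockWord_oneDefect] at hl
  have h1 : n + 3 = 2 * e + 2 * g + t.toNat := by omega
  rw [← hl, h1]
  exact ⟨peak_le_run_oneDefect (u := 0) (y := 1) (by norm_num) h,
    run_oneDefect_lt_peak 0 (y := 1) (by norm_num) e g t⟩

theorem run_none {n m : ℕ} {t : Bool} (hl : (blockWord (List.replicate m 0) t).length = n + 6) :
    run 1 1 (blockWord (List.replicate m 0) t) = peak 1 1 (n + 6) := by
  rw [length_blockWord_replicate] at hl
  rw [blockWord_replicate, run_altWord, hl]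

/-- These thresholds separate the values of the five shapes, in the order of their indices. -/
theorem peak_chain (n : ℕ) :
    peak 5 4 (n + 2) < peak 15 11 n ∧ peak 15 11 n < peak 4 3 (n + 3) ∧
      peak 4 3 (n + 3) < peak 1 1 (n + 6) := by
  obtain ⟨h2, h3, h4, h5, h6⟩ := fib_add_eq n
  have h7 := Nat.fib_add_two (n := n + 5)
  have h8 : 0 < Nat.fib (n + 1) := Nat.fib_pos.mpr (by omega)
  simp only [peak, add_assoc, Nat.reduceAdd] at *
  omega

theorem replicate_append_oneDefect (e j g : ℕ) :
    oneDefect (e + j + 1) g = List.replicate e 0 ++ 0 :: oneDefect j g := by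
  rw [oneDefect, show e + j + 1 = e + (j + 1) by ring, List.replicate_add, List.replicate_succ,
    List.append_assoc, List.cons_append, oneDefect]

theorem replicate_add_succ (e j : ℕ) :
    List.replicate (e + j + 1) 0 = List.replicate e 0 ++ 0 :: List.replicate j 0 := by
  rw [show e + j + 1 = e + (j + 1) by ring, List.replicate_add, List.replicate_succ]

theorem appendBits_oneDefect_lt_replicate (p : List ℕ) {e g m : ℕ} {t s : Bool}
    (hl : (blockWord (p ++ oneDefect e g) t).length =
      (blockWord (p ++ List.replicate m 0) s).length) :
    appendBits 1 (blockWord (p ++ oneDefect e g) t) <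
      appendBits 1 (blockWord (p ++ List.replicate m 0) s) := by
  have hm : e < m := by
    rw [blockWord_append, blockWord_append, List.length_append, List.length_append,
      length_blockWord_oneDefect, length_blockWord_replicate] at hl
    have := Bool.toNat_le s
    omega
  obtain ⟨j, rfl⟩ := Nat.exists_eq_add_of_lt hm
  rw [replicate_add_succ, oneDefect, ← List.append_assoc, ← List.append_assoc] at hl ⊢
  exact appendBits_blockWord_lt _ zero_lt_one _ _ _ _ hl

theorem appendBits_oneDefect_lt (p : List ℕ) {e g e' g' : ℕ} {t s : Bool} (he : e < e')
    (hl : (blockWord (p ++ oneDefect e g) t).length =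
      (blockWord (p ++ oneDefect e' g') s).length) :
    appendBits 1 (blockWord (p ++ oneDefect e g) t) <
      appendBits 1 (blockWord (p ++ oneDefect e' g') s) := by
  obtain ⟨j, rfl⟩ := Nat.exists_eq_add_of_lt he
  rw [replicate_append_oneDefect, oneDefect, ← List.append_assoc, ← List.append_assoc] at hl ⊢
  exact appendBits_blockWord_lt _ zero_lt_one _ _ _ _ hl

/-- Among the candidates of the same large length, a later one has a larger value. -/
theorem IsRecordShape.run_lt_run {ds es : List ℕ} {t s : Bool} {n : ℕ} (hn : 5 ≤ n)
    (hd : IsRecordShape ds t) (he : IsRecordShape es s)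
    (hdl : (blockWord ds t).length = n + 6) (hel : (blockWord es s).length = n + 6)
    (hlt : appendBits 1 (blockWord ds t) < appendBits 1 (blockWord es s)) :
    run 1 1 (blockWord ds t) < run 1 1 (blockWord es s) := by
  obtain ⟨hAB, hBC, hCD⟩ := peak_chain n
  have hl := hdl.trans hel.symm
  cases hd with
  | double m t =>
    rw [run_double hdl]
    cases he with
    | double m' s =>
      exfalso
      simp only [length_blockWord_cons, length_blockWord_replicate] at hl
      have h := Bool.toNat_le t
      have h' := Bool.toNat_le s
      obtain rfl : m = m' := by omega
      obtain rfl : t = s := by cases t <;> cases s <;> simp at hl ⊢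
      exact lt_irrefl _ hlt
    | triple e' => exact (run_triple_mem hn hel).1
    | pair e' g' s h => exact hAB.trans_le (run_pair_mem h hel).1
    | single e' g' s h => exact (hAB.trans hBC).trans_le (run_single_mem h hel).1
    | none m' s => rw [run_none hel]; omega
  | triple e =>
    have hv := (run_triple_mem hn hdl).2
    cases he with
    | double m' s =>
      exact absurd hlt (appendBits_blockWord_lt [] (by norm_num) _ _ _ _ hl.symm).le.not_gt
    | triple e' =>
      exfalso
      simp only [length_blockWord_cons, length_blockWord_oneDefect] at hl
      obtain rfl : e = e' := by omega
      exact lt_irrefl _ hlt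
    | pair e' g' s h => exact hv.trans_le (run_pair_mem h hel).1
    | single e' g' s h => exact (hv.trans hBC).trans_le (run_single_mem h hel).1
    | none m' s => rw [run_none hel]; omega
  | pair e g t h =>
    have hv := (run_pair_mem h hdl).2
    cases he with
    | double m' s =>
      exact absurd hlt (appendBits_blockWord_lt [] (by norm_num) _ _ _ _ hl.symm).le.not_gt
    | triple e' =>
      refine absurd hlt (le_of_lt ?_).not_gt
      rcases e with _ | e
      · exact appendBits_oneDefect_lt_replicate [1, 1] hl.symm
      · exact appendBits_blockWord_lt [1] zero_lt_one (oneDefect e' 0) (oneDefect e g) _ _ hl.symm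
    | pair e' g' s h' =>
      rcases Nat.lt_or_ge e' e with hee | hee
      · exact absurd hlt (appendBits_oneDefect_lt [1] hee hl.symm).le.not_gt
      · simp only [length_blockWord_cons, length_blockWord_oneDefect] at hl
        obtain rfl : t = s := by cases t <;> cases s <;> simp at hl ⊢ <;> omega
        rcases hee.eq_or_lt with rfl | hee
        · obtain rfl : g = g' := by omega
          exact absurd hlt (lt_irrefl _)
        · rw [run_blockWord_cons, run_blockWord_cons]
          exact run_oneDefect_lt (u := 1) (y := 3) (by norm_num) h' (by omega) hee
    | single e' g' s h' => exact hv.trans_le (run_single_mem h' hel).1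
    | none m' s => rw [run_none hel]; omega
  | single e g t h =>
    have hv := (run_single_mem h hdl).2
    cases he with
    | double m' s =>
      refine absurd hlt (le_of_lt ?_).not_gt
      rcases e with _ | e <;>
      exact appendBits_blockWord_lt [] (by norm_num) _ _ _ _ hl.symm
    | triple e' =>
      refine absurd hlt (le_of_lt ?_).not_gt
      rcases e with _ | e
      · rcases g with _ | g
        · rw [length_blockWord_oneDefect] at hdl
          have := Bool.toNat_le t
          omega
        · exact appendBits_blockWord_lt [1] zero_lt_one _ _ _ _ hl.symm
      · exact appendBits_blockWord_lt [] zero_lt_one _ _ _ _ hl.symm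
    | pair e' g' s h' =>
      refine absurd hlt (le_of_lt ?_).not_gt
      rcases e with _ | e
      · exact appendBits_oneDefect_lt_replicate [1] hl.symm
      · exact appendBits_blockWord_lt [] zero_lt_one (oneDefect e' g') (oneDefect e g) _ _ hl.symm
    | single e' g' s h' =>
      rcases Nat.lt_or_ge e' e with hee | hee
      · exact absurd hlt (appendBits_oneDefect_lt [] hee hl.symm).le.not_gt
      · simp only [length_blockWord_oneDefect] at hl
        obtain rfl : t = s := by cases t <;> cases s <;> simp at hl ⊢ <;> omega
        rcases hee.eq_or_lt with rfl | hee
        · obtain rfl : g = g' := by omega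
          exact absurd hlt (lt_irrefl _)
        · exact run_oneDefect_lt (u := 0) (y := 1) (by norm_num) h' (by omega) hee
    | none m' s => rwa [run_none hel]
  | none m t =>
    rcases m with _ | m
    · rw [length_blockWord_replicate] at hdl
      have := Bool.toNat_le t
      omega
    cases he with
    | double m' s => exact absurd hlt (appendBits_blockWord_lt [] two_pos _ _ _ _ hl.symm).le.not_gt
    | triple e' =>
      exact absurd hlt
        (appendBits_blockWord_lt [] zero_lt_one (1 :: oneDefect e' 0) _ _ _ hl.symm).le.not_gt
    | pair e' g' s h' =>
      exact absurd hlt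
        (appendBits_blockWord_lt [] zero_lt_one (oneDefect e' g') _ _ _ hl.symm).le.not_gt
    | single e' g' s h' =>
      exact absurd hlt (appendBits_oneDefect_lt_replicate (m := m + 1) (s := t) [] hl.symm).le.not_gt
    | none m' s =>
      simp only [length_blockWord_replicate] at hdl hel
      rw [blockWord_replicate, blockWord_replicate, hdl, hel] at hlt
      exact absurd hlt (lt_irrefl _)

/-- All candidates of large length exceed the maximum over the shorter words. -/
theorem IsRecordShape.fib_lt_run {ds : List ℕ} {t : Bool} {n : ℕ} (hn : 5 ≤ n)
    (hd : IsRecordShape ds t) (hl : (blockWord ds t).length = n + 6) :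
    Nat.fib (n + 7) < run 1 1 (blockWord ds t) := by
  obtain ⟨hAB, hBC, hCD⟩ := peak_chain n
  have hA : Nat.fib (n + 7) < peak 5 4 (n + 2) := by
    obtain ⟨-, -, -, h, -⟩ := fib_add_eq (n + 2)
    have h1 : 0 < Nat.fib (n + 2) := Nat.fib_pos.mpr (by omega)
    simp only [peak, add_assoc, Nat.reduceAdd] at *
    omega
  cases hd with
  | double m t => rwa [run_double hl]
  | triple e => exact hA.trans (run_triple_mem hn hl).1
  | pair e g t h => exact (hA.trans hAB).trans_le (run_pair_mem h hl).1
  | single e g t h => exact ((hA.trans hAB).trans hBC).trans_le (run_single_mem h hl).1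
  | none m t => rw [run_none hl]; omega

/-- A word of length at least `11`, preceded by the digit `1`, represents a record-setter
exactly if it has one of the candidate shapes. -/
theorem isRecordSetter_appendBits_iff {w : List Bool} (hw : 11 ≤ w.length) :
    IsRecordSetter stern (appendBits 1 w) ↔ ∃ ds t, IsRecordShape ds t ∧ w = blockWord ds t := by
  constructor
  · intro hr
    obtain ⟨ds, t, rfl⟩ := hr.exists_blockWord
    exact ⟨ds, t, hr.isRecordShape hw, rfl⟩
  · rintro ⟨ds, t, hd, rfl⟩
    obtain ⟨n, hn⟩ := Nat.exists_eq_add_of_le' (show 6 ≤ (blockWord ds t).length by omega)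
    by_contra hr
    have hex : ∃ i, stern (appendBits 1 (blockWord ds t)) ≤ stern i ∧
        i < appendBits 1 (blockWord ds t) := by
      simpa [IsRecordSetter, and_comm] using hr
    have hex' : ∃ i, stern (appendBits 1 (blockWord ds t)) ≤ stern i := ⟨_, hex.choose_spec.1⟩
    classical
    -- The least index reaching the value is itself a record-setter. It has the same length, hence a
    -- candidate shape, and monotonicity among candidates excludes that it is smaller.
    obtain ⟨i, hi, hmin⟩ : ∃ i, stern (appendBits 1 (blockWord ds t)) ≤ stern i ∧
        ∀ j < i, stern j < stern (appendBits 1 (blockWord ds t)) :=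
      ⟨Nat.find hex', Nat.find_spec hex', fun j hj => not_le.mp (Nat.find_min hex' hj)⟩
    have hlt : i < appendBits 1 (blockWord ds t) := by
      obtain ⟨j, hj, hjlt⟩ := hex
      refine lt_of_le_of_lt ?_ hjlt
      by_contra! h
      exact absurd (hmin j h) (not_lt_of_ge hj)
    have hirec : IsRecordSetter stern i := fun j hj => (hmin j hj).trans_le hi
    have hfib := hd.fib_lt_run (by omega) hn
    have hi0 : i ≠ 0 := by
      rintro rfl
      rw [stern_appendBits_one, stern_zero] at hi
      omega
    obtain ⟨w, rfl⟩ := exists_appendBits hi0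
    rw [stern_appendBits_one, stern_appendBits_one] at hi
    have hwl : w.length = n + 6 := by
      refine le_antisymm ?_ ?_
      · by_contra! h
        exact absurd hlt (appendBits_one_lt_of_length_lt (by omega)).le.not_gt
      · by_contra! h
        have h1 := run_le_peak (le_refl 1) w
        rw [peak_one_one] at h1
        have h2 : Nat.fib (w.length + 2) ≤ Nat.fib (n + 7) := Nat.fib_mono (by omega)
        omega
    obtain ⟨es, s, rfl⟩ := hirec.exists_blockWord
    have hes := hirec.isRecordShape (by omega)
    exact absurd (hes.run_lt_run (by omega) hd hwl hn hlt) (not_lt_of_ge hi)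

/-! ### Finite unions of linear patterns are context-free -/

/-- The concatenation of `n` copies of the word `u`. -/
def wordPow {T : Type} (u : List T) (n : ℕ) : List T := (List.replicate n u).flatten

theorem wordPow_succ {T : Type} (u : List T) (n : ℕ) : wordPow u (n + 1) = u ++ wordPow u n := by
  simp [wordPow, List.replicate_succ]

theorem wordPow_succ' {T : Type} (u : List T) (n : ℕ) :
    wordPow u (n + 1) = wordPow u n ++ u := by
  simp [wordPow, List.replicate_succ']

@[simp] theorem wordPow_zero {T : Type} (u : List T) : wordPow u 0 = [] := rfl

@[simp] theorem wordPow_nil {T : Type} (n : ℕ) : wordPow ([] : List T) n = [] := by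
  simp [wordPow]

theorem wordPow_add {T : Type} (u : List T) (m n : ℕ) :
    wordPow u (m + n) = wordPow u m ++ wordPow u n := by
  rw [wordPow, List.replicate_add, List.flatten_append]
  rfl

theorem length_wordPow {T : Type} (u : List T) (n : ℕ) :
    (wordPow u n).length = n * u.length := by
  simp [wordPow]

/-- A pattern describing the words `pre uⁱ mid vⁱ wʲ post`. -/
structure LinearPattern (T : Type) where
  pre : List T
  u : List T
  mid : List T
  v : List T
  w : List T
  post : List T

namespace LinearPattern

variable {T : Type}

/-- The word `uⁱ mid vⁱ`. -/
def core (p : LinearPattern T) (i : ℕ) : List T := wordPow p.u i ++ p.mid ++ wordPow p.v i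

/-- The word `pre uⁱ mid vⁱ wʲ post`. -/
def word (p : LinearPattern T) (i j : ℕ) : List T :=
  p.pre ++ (p.core i ++ wordPow p.w j) ++ p.post

/-- The nonterminals: the initial one, and for each pattern one that produces the words
`uⁱ mid vⁱ wʲ` and one that produces the words `uⁱ mid vⁱ`. -/
abbrev NonTerminal (T : Type) : Type := Option (LinearPattern T × Bool)

/-- The grammar rules for a pattern. -/
def rules (p : LinearPattern T) : List (ContextFreeRule T (NonTerminal T)) :=
  [⟨none, p.pre.map .terminal ++ .nonterminal (some (p, false)) :: p.post.map .terminal⟩,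
   ⟨some (p, false), .nonterminal (some (p, false)) :: p.w.map .terminal⟩,
   ⟨some (p, false), [.nonterminal (some (p, true))]⟩,
   ⟨some (p, true), p.u.map .terminal ++ .nonterminal (some (p, true)) :: p.v.map .terminal⟩,
   ⟨some (p, true), p.mid.map .terminal⟩]

open Classical in
/-- The grammar generating the words of finitely many patterns. -/
noncomputable abbrev grammar (s : Finset (LinearPattern T)) : ContextFreeGrammar T where
  NT := NonTerminal T
  initial := none
  rules := s.biUnion fun p => p.rules.toFinset

/-- The words produced by a nonterminal. -/
def ntLanguage (s : Finset (LinearPattern T)) : NonTerminal T → Language T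
  | none => {x | ∃ p ∈ s, ∃ i j, x = p.word i j}
  | some (p, false) => {x | ∃ i j, x = p.core i ++ wordPow p.w j}
  | some (p, true) => {x | ∃ i, x = p.core i}

/-- The words produced by a symbol. -/
def symbolLanguage (s : Finset (LinearPattern T)) : Symbol T (NonTerminal T) → Language T
  | .terminal a => {[a]}
  | .nonterminal n => ntLanguage s n

/-- The words produced by a sentential form. -/
def formLanguage (s : Finset (LinearPattern T)) (f : List (Symbol T (NonTerminal T))) :
    Language T :=
  (f.map (symbolLanguage s)).prod

theorem formLanguage_append (s : Finset (LinearPattern T))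
    (f g : List (Symbol T (NonTerminal T))) :
    formLanguage s (f ++ g) = formLanguage s f * formLanguage s g := by
  simp [formLanguage]

theorem formLanguage_cons (s : Finset (LinearPattern T)) (a : Symbol T (NonTerminal T))
    (g : List (Symbol T (NonTerminal T))) :
    formLanguage s (a :: g) = symbolLanguage s a * formLanguage s g := by
  simp [formLanguage]

theorem mem_formLanguage_terminal (s : Finset (LinearPattern T)) (x y : List T) :
    y ∈ formLanguage s (x.map .terminal) ↔ y = x := by
  induction x generalizing y with
  | nil => simp [formLanguage, Language.mem_one]
  | cons a x ih =>
    rw [List.map_cons, formLanguage_cons, Language.mem_mul]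
    constructor
    · rintro ⟨b, hb, c, hc, rfl⟩
      rw [ih] at hc
      have hb : b = [a] := hb
      simp [hb, hc]
    · rintro rfl
      exact ⟨[a], rfl, x, (ih x).mpr rfl, rfl⟩

theorem mem_ntLanguage_of_mem_output {s : Finset (LinearPattern T)} {p : LinearPattern T} (hp : p ∈ s)
    {r : ContextFreeRule T (NonTerminal T)} (hr : r ∈ p.rules) :
    ∀ x ∈ formLanguage s r.output, x ∈ ntLanguage s r.input := by
  intro x hx
  simp only [rules, List.mem_cons, List.not_mem_nil, or_false] at hr
  rcases hr with rfl | rfl | rfl | rfl | rfl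
  · simp only [formLanguage_append, formLanguage_cons, Language.mem_mul,
      mem_formLanguage_terminal] at hx
    obtain ⟨a, rfl, b, ⟨c, ⟨i, j, rfl⟩, d, rfl, rfl⟩, rfl⟩ := hx
    exact ⟨p, hp, i, j, by simp [word]⟩
  · simp only [formLanguage_cons, Language.mem_mul, mem_formLanguage_terminal] at hx
    obtain ⟨c, ⟨i, j, rfl⟩, d, rfl, rfl⟩ := hx
    exact ⟨i, j + 1, by simp [wordPow_succ']⟩
  · simp only [formLanguage, List.map_cons, List.map_nil, List.prod_singleton] at hx
    obtain ⟨i, rfl⟩ := hx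
    exact ⟨i, 0, by simp⟩
  · simp only [formLanguage_append, formLanguage_cons, Language.mem_mul,
      mem_formLanguage_terminal] at hx
    obtain ⟨a, rfl, b, ⟨c, ⟨i, rfl⟩, d, rfl, rfl⟩, rfl⟩ := hx
    refine ⟨i + 1, ?_⟩
    rw [core, core, wordPow_succ, wordPow_succ']
    simp
  · rw [mem_formLanguage_terminal] at hx
    exact ⟨0, by simp [hx, core]⟩

theorem mem_grammar_rules {s : Finset (LinearPattern T)}
    {r : ContextFreeRule T (NonTerminal T)} :
    r ∈ (grammar s).rules ↔ ∃ p ∈ s, r ∈ p.rules := by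
  classical
  refine Finset.mem_biUnion.trans ?_
  simp only [List.mem_toFinset]

/-- Each rule is sound for the intended languages of the nonterminals, and concatenation is
monotone, so a rewriting step can only shrink the language of a form. -/
theorem formLanguage_le_of_derives {s : Finset (LinearPattern T)}
    {f g : List (Symbol T (NonTerminal T))} (h : (grammar s).Derives f g) :
    formLanguage s g ≤ formLanguage s f := by
  induction h with
  | refl => exact le_rfl
  | tail _ hstep ih =>
    refine le_trans ?_ ih
    obtain ⟨r, hr, hrw⟩ := hstep
    obtain ⟨a, b, rfl, rfl⟩ := hrw.exists_parts
    obtain ⟨p, hp, hr⟩ := mem_grammar_rules.mp hr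
    have h1 : formLanguage s [Symbol.nonterminal r.input] = ntLanguage s r.input := by
      simp [formLanguage, symbolLanguage]
    simp only [formLanguage_append, h1]
    exact mul_le_mul' (mul_le_mul' le_rfl (mem_ntLanguage_of_mem_output hp hr)) le_rfl

theorem produces_of_mem {s : Finset (LinearPattern T)} {p : LinearPattern T} (hp : p ∈ s)
    {r : ContextFreeRule T (NonTerminal T)} (hr : r ∈ p.rules) :
    (grammar s).Derives [.nonterminal r.input] r.output := by
  exact ContextFreeGrammar.Produces.single
    ⟨r, mem_grammar_rules.mpr ⟨p, hp, hr⟩, ContextFreeRule.Rewrites.input_output⟩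

theorem derives_core {s : Finset (LinearPattern T)} {p : LinearPattern T} (hp : p ∈ s) (i : ℕ) :
    (grammar s).Derives [.nonterminal (some (p, true))] ((p.core i).map .terminal) := by
  induction i with
  | zero =>
    simpa [core] using produces_of_mem hp (r := ⟨some (p, true), p.mid.map .terminal⟩)
      (by simp [rules])
  | succ i ih =>
    refine (produces_of_mem hp (r := ⟨some (p, true), p.u.map .terminal ++
      .nonterminal (some (p, true)) :: p.v.map .terminal⟩) (by simp [rules])).trans ?_
    have h := (ih.append_right (p.v.map .terminal)).append_left (p.u.map .terminal)
    rw [core, wordPow_succ, wordPow_succ']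
    simpa [core] using h

theorem derives_tail {s : Finset (LinearPattern T)} {p : LinearPattern T} (hp : p ∈ s) (i j : ℕ) :
    (grammar s).Derives [.nonterminal (some (p, false))]
      ((p.core i ++ wordPow p.w j).map .terminal) := by
  induction j with
  | zero =>
    refine (produces_of_mem hp (r := ⟨some (p, false), [.nonterminal (some (p, true))]⟩)
      (by simp [rules])).trans ?_
    simpa using derives_core hp i
  | succ j ih =>
    refine (produces_of_mem hp (r := ⟨some (p, false),
      .nonterminal (some (p, false)) :: p.w.map .terminal⟩) (by simp [rules])).trans ?_
    have h := ih.append_right (p.w.map .terminal)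
    rw [wordPow_succ']
    simpa using h

theorem derives_word {s : Finset (LinearPattern T)} {p : LinearPattern T} (hp : p ∈ s) (i j : ℕ) :
    (grammar s).Derives [.nonterminal none] ((p.word i j).map .terminal) := by
  refine (produces_of_mem hp (r := ⟨none, p.pre.map .terminal ++
    .nonterminal (some (p, false)) :: p.post.map .terminal⟩) (by simp [rules])).trans ?_
  have h := ((derives_tail hp i j).append_right (p.post.map .terminal)).append_left
    (p.pre.map .terminal)
  simpa [word] using h

theorem isContextFree_of_finite {S : Set (LinearPattern T)} (hS : S.Finite) :
    Language.IsContextFree ({x | ∃ p ∈ S, ∃ i j, x = p.word i j} : Language T) := by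
  refine ⟨grammar hS.toFinset, ?_⟩
  ext x
  rw [ContextFreeGrammar.mem_language_iff]
  constructor
  · intro h
    have h1 := formLanguage_le_of_derives h ((mem_formLanguage_terminal _ x x).mpr rfl)
    have h2 : formLanguage hS.toFinset [Symbol.nonterminal none] =
        ntLanguage hS.toFinset none := by
      simp [formLanguage, symbolLanguage]
    obtain ⟨p, hp, i, j, rfl⟩ : x ∈ ntLanguage hS.toFinset none := h2 ▸ h1
    exact ⟨p, by simpa using hp, i, j, rfl⟩
  · rintro ⟨p, hp, i, j, rfl⟩
    exact derives_word (by simpa using hp) i j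

end LinearPattern

/-! ### Ignoring finitely many short words -/

namespace LinearPattern

variable {T : Type}

/-- The pattern whose words are those of `p` with exponents at least `a` and `b`. -/
def shift (p : LinearPattern T) (a b : ℕ) : LinearPattern T :=
  ⟨p.pre ++ wordPow p.u a, p.u, p.mid ++ wordPow p.v a, p.v, p.w, wordPow p.w b ++ p.post⟩

theorem word_shift (p : LinearPattern T) (a b i j : ℕ) :
    (p.shift a b).word i j = p.word (a + i) (b + j) := by
  simp only [word, core, shift, wordPow_add, add_comm b j]
  simp only [List.append_assoc]

theorem length_word (p : LinearPattern T) (i j : ℕ) :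
    (p.word i j).length = p.pre.length + p.mid.length + p.post.length +
      i * (p.u.length + p.v.length) + j * p.w.length := by
  simp only [word, core, List.length_append, length_wordPow]
  ring

/-- Capping an exponent at `K` either changes nothing, or the repeated word is empty, or its `K`
copies already have length at least `K`. -/
theorem le_length_word_min (p : LinearPattern T) {K i j : ℕ} (h : K ≤ (p.word i j).length) :
    K ≤ (p.word (min i K) (min j K)).length := by
  rw [length_word] at h ⊢
  have key : ∀ n c : ℕ, min n K * c = n * c ∨ K ≤ min n K * c := by
    intro n c
    rcases le_total n K with hn | hn
    · exact .inl (by rw [min_eq_left hn])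
    · rw [min_eq_right hn]
      rcases Nat.eq_zero_or_pos c with rfl | hc
      · exact .inl (by simp)
      · exact .inr (Nat.le_mul_of_pos_right K hc)
  rcases key i (p.u.length + p.v.length) with h1 | h1 <;>
    rcases key j p.w.length with h2 | h2 <;> omega

/-- A language whose long words are those of finitely many patterns is context-free. -/
theorem isContextFree_of_long [Finite T] {L : Language T} {B : Set (LinearPattern T)}
    (hB : B.Finite) (K : ℕ)
    (h : ∀ x : List T, K ≤ x.length → (x ∈ L ↔ ∃ p ∈ B, ∃ i j, x = p.word i j)) :
    L.IsContextFree := by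
  let short : Set (LinearPattern T) :=
    (fun x : List T => (⟨x, [], [], [], [], []⟩ : LinearPattern T)) ''
      {x : List T | x.length < K ∧ x ∈ L}
  -- Shifting by capped exponents whose word is already long ensures that every word of these
  -- patterns is long.
  let long : Set (LinearPattern T) :=
    (fun q : LinearPattern T × ℕ × ℕ => q.1.shift q.2.1 q.2.2) ''
      {q | q ∈ B ×ˢ (Set.Iic K ×ˢ Set.Iic K) ∧ K ≤ (q.1.word q.2.1 q.2.2).length}
  have hs : short.Finite :=
    ((List.finite_length_lt T K).subset fun x hx => hx.1).image _
  have hl : long.Finite :=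
    ((hB.prod ((Set.finite_Iic K).prod (Set.finite_Iic K))).subset fun q hq => hq.1).image _
  suffices hL : L = ({x | ∃ p ∈ short ∪ long, ∃ i j, x = p.word i j} : Language T) by
    rw [hL]
    exact isContextFree_of_finite (hs.union hl)
  ext x
  change x ∈ L ↔ ∃ p ∈ short ∪ long, ∃ i j, x = p.word i j
  constructor
  · intro hx
    rcases Nat.lt_or_ge x.length K with hK | hK
    · exact ⟨_, .inl ⟨x, ⟨hK, hx⟩, rfl⟩, 0, 0, by simp [word, core]⟩
    · obtain ⟨p, hp, i, j, rfl⟩ := (h x hK).mp hx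
      refine ⟨_, .inr ⟨(p, min i K, min j K), ⟨Set.mk_mem_prod hp (Set.mk_mem_prod
        (Set.mem_Iic.mpr (min_le_right _ _)) (Set.mem_Iic.mpr (min_le_right _ _))),
        p.le_length_word_min hK⟩, rfl⟩, i - min i K, j - min j K, ?_⟩
      rw [word_shift, Nat.add_sub_cancel' (min_le_left _ _),
        Nat.add_sub_cancel' (min_le_left _ _)]
  · rintro ⟨_, ⟨y, ⟨-, hy⟩, rfl⟩ | ⟨⟨p, a, b⟩, ⟨⟨hp, -⟩, hK⟩, rfl⟩, i, j, rfl⟩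
    · simpa [word, core] using hy
    · change K ≤ (p.word a b).length at hK
      change (p.shift a b).word i j ∈ L
      rw [word_shift]
      refine (h _ ?_).mpr ⟨p, hp, _, _, rfl⟩
      rw [length_word] at hK ⊢
      have h1 := Nat.mul_le_mul_right (p.u.length + p.v.length) (Nat.le_add_right a i)
      have h2 := Nat.mul_le_mul_right p.w.length (Nat.le_add_right b j)
      omega

end LinearPattern

/-! ### The patterns of the record-setters -/

/-- The words `pre (01)ⁿ post`. -/
def plainPattern (pre post : List Bool) : LinearPattern Bool :=
  ⟨pre, [], [], [], [false, true], post⟩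

/-- The words `pre (01)ᵉ 001 (01)ᵍ 1` if `t` holds, and the words `pre (01)ᵉ 001 (01)ᵍ`
with `e ≤ g` otherwise. -/
def defectPattern (pre : List Bool) (t : Bool) : LinearPattern Bool :=
  -- Without a final 1, `v` matches the blocks before the defect and `w` supplies the surplus g − e.
  ⟨pre, [false, true], [false, false, true], if t then [] else [false, true], [false, true],
    blockWord [] t⟩

theorem blockWord_replicate_eq_wordPow (m : ℕ) (t : Bool) :
    blockWord (List.replicate m 0) t = wordPow [false, true] m ++ blockWord [] t := by
  induction m with
  | zero => simp
  | succ m ih =>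
    rw [List.replicate_succ, blockWord, ih, wordPow_succ]
    rfl

theorem word_plainPattern (pre : List Bool) (t : Bool) (i j : ℕ) :
    (plainPattern pre (blockWord [] t)).word i j =
      pre ++ blockWord (List.replicate j 0) t := by
  simp [plainPattern, LinearPattern.word, LinearPattern.core, blockWord_replicate_eq_wordPow]

theorem blockWord_oneDefect (e g : ℕ) (t : Bool) :
    blockWord (oneDefect e g) t = wordPow [false, true] e ++ false :: false :: true ::
      (wordPow [false, true] g ++ blockWord [] t) := by
  rw [oneDefect, blockWord_append, blockWord_replicate_eq_wordPow,
    blockWord.eq_def (1 :: List.replicate g 0)]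
  simp [blockWord, blockWord_replicate_eq_wordPow g]

theorem word_defectPattern_true (pre : List Bool) (e g : ℕ) :
    (defectPattern pre true).word e g = pre ++ blockWord (oneDefect e g) true := by
  simp [defectPattern, LinearPattern.word, LinearPattern.core, blockWord_oneDefect]

theorem word_defectPattern_false (pre : List Bool) (e j : ℕ) :
    (defectPattern pre false).word e j = pre ++ blockWord (oneDefect e (e + j)) false := by
  simp [defectPattern, LinearPattern.word, LinearPattern.core, blockWord_oneDefect, wordPow_add]

/-- The patterns of the binary representations of the large record-setters. -/
def recordPatterns : Set (LinearPattern Bool) :=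
  {plainPattern [true, false, false, true, false, false, true] [false, false, true, true]} ∪
    (Set.range (fun t => plainPattern [true, false, false, false, true] (blockWord [] t)) ∪
      Set.range (fun t => plainPattern [true] (blockWord [] t)) ∪
      Set.range (fun t => defectPattern [true, false, false, true] t) ∪
      Set.range (fun t => defectPattern [true] t))

theorem finite_recordPatterns : recordPatterns.Finite :=
  (Set.finite_singleton _).union ((((Set.finite_range _).union (Set.finite_range _)).union
    (Set.finite_range _)).union (Set.finite_range _))

theorem exists_word_defectPattern (p : List Bool) {e g : ℕ} {t : Bool} (h : t = true ∨ e ≤ g) :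
    ∃ i j, p ++ blockWord (oneDefect e g) t = (defectPattern p t).word i j := by
  cases t
  · obtain ⟨j, rfl⟩ := Nat.exists_eq_add_of_le (by simpa using h : e ≤ g)
    exact ⟨e, j, (word_defectPattern_false p e j).symm⟩
  · exact ⟨e, g, (word_defectPattern_true p e g).symm⟩

theorem exists_word_defectPattern_eq (p : List Bool) (t : Bool) (i j : ℕ) :
    ∃ e g, (t = true ∨ e ≤ g) ∧ (defectPattern p t).word i j = p ++ blockWord (oneDefect e g) t := by
  cases t
  · exact ⟨i, i + j, .inr (Nat.le_add_right _ _), word_defectPattern_false p i j⟩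
  · exact ⟨i, j, .inl rfl, word_defectPattern_true p i j⟩

theorem word_plainPattern_triple (i e : ℕ) :
    (plainPattern [true, false, false, true, false, false, true] [false, false, true, true]).word
      i e = true :: blockWord (1 :: 1 :: oneDefect e 0) true := by
  rw [blockWord, blockWord, blockWord_oneDefect]
  simp [plainPattern, LinearPattern.word, LinearPattern.core, blockWord]

theorem exists_isRecordShape_iff (w : List Bool) :
    (∃ ds t, IsRecordShape ds t ∧ w = blockWord ds t) ↔
      ∃ p ∈ recordPatterns, ∃ i j, true :: w = p.word i j := by
  constructor
  · rintro ⟨ds, t, hd, rfl⟩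
    cases hd with
    | double m t =>
      exact ⟨_, .inr (.inl (.inl (.inl ⟨t, rfl⟩))), 0, m,
        (word_plainPattern [true, false, false, false, true] t 0 m).symm⟩
    | triple e => exact ⟨_, .inl rfl, 0, e, (word_plainPattern_triple 0 e).symm⟩
    | pair e g t h =>
      exact ⟨_, .inr (.inl (.inr ⟨t, rfl⟩)),
        exists_word_defectPattern [true, false, false, true] h⟩
    | single e g t h => exact ⟨_, .inr (.inr ⟨t, rfl⟩), exists_word_defectPattern [true] h⟩
    | none m t => exact ⟨_, .inr (.inl (.inl (.inr ⟨t, rfl⟩))), 0, m,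
        (word_plainPattern [true] t 0 m).symm⟩
  · rintro ⟨p, rfl | ((⟨t, rfl⟩ | ⟨t, rfl⟩) | ⟨t, rfl⟩) | ⟨t, rfl⟩, i, j, h⟩
    · exact ⟨_, _, .triple j, by simpa [word_plainPattern_triple] using h⟩
    · refine ⟨_, t, .double j t, ?_⟩
      rw [word_plainPattern] at h
      exact (List.cons.inj h).2
    · refine ⟨_, t, .none j t, ?_⟩
      rw [word_plainPattern] at h
      exact (List.cons.inj h).2
    · obtain ⟨e, g, hc, hw⟩ := exists_word_defectPattern_eq [true, false, false, true] t i j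
      refine ⟨_, t, .pair e g t hc, ?_⟩
      exact (List.cons.inj (h.trans hw)).2
    · obtain ⟨e, g, hc, hw⟩ := exists_word_defectPattern_eq [true] t i j
      exact ⟨_, t, .single e g t hc, (List.cons.inj (h.trans hw)).2⟩

/-! ### From digit words to the language -/

theorem mem_sternRecordLanguage_cons (w : List Bool) :
    true :: w ∈ sternRecordLanguage ↔ IsRecordSetter stern (appendBits 1 w) := by
  constructor
  · rintro ⟨v, hv, hw⟩
    obtain ⟨u, rfl⟩ := exists_appendBits (v := v) (by
      rintro rfl
      simp [binaryRep] at hw)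
    rw [binaryRep_appendBits_one] at hw
    rwa [(List.cons.inj hw).2] at hv
  · intro h
    exact ⟨_, h, binaryRep_appendBits_one w⟩

theorem false_cons_notMem_sternRecordLanguage (w : List Bool) :
    false :: w ∉ sternRecordLanguage := by
  rintro ⟨v, -, hw⟩
  rcases eq_or_ne v 0 with rfl | hv
  · simp [binaryRep] at hw
  · obtain ⟨u, rfl⟩ := exists_appendBits hv
    rw [binaryRep_appendBits_one] at hw
    simp at hw

theorem exists_cons_of_mem_recordPatterns {p : LinearPattern Bool} (hp : p ∈ recordPatterns)
    (i j : ℕ) : ∃ w, p.word i j = true :: w := by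
  rcases hp with rfl | ((⟨t, rfl⟩ | ⟨t, rfl⟩) | ⟨t, rfl⟩) | ⟨t, rfl⟩ <;> exact ⟨_, rfl⟩

theorem mainTheorem5 : sternRecordLanguage.IsContextFree := by
  -- The leading digit 1 and at least 11 further digits.
  refine LinearPattern.isContextFree_of_long finite_recordPatterns 12 fun x hx => ?_
  rcases x with _ | ⟨_ | _, w⟩
  · simp at hx
  · refine iff_of_false (false_cons_notMem_sternRecordLanguage w) ?_
    rintro ⟨p, hp, i, j, h⟩
    obtain ⟨u, hu⟩ := exists_cons_of_mem_recordPatterns hp i j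
    rw [hu] at h
    simp at h
  · rw [mem_sternRecordLanguage_cons, isRecordSetter_appendBits_iff (by simpa using hx),
      exists_isRecordShape_iff]
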